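/- Let $q$ be a prime power and let $PG(N,q)$ be the $N$-dimensional projective space over the field with $q$ elements. A point set $S\subset PG(N,q)$ is called saturating if every point of $PG(N,q)\setminus S$ is collinear with two distinct points of $S$; let $s(N,q)$ be the smallest size of a saturating set in $PG(N,q)$. The length function $\ell(R,r,q)$ is the smallest length $n$ of a $q$-ary linear code of codimension $r$ (i.e. of dimension $n-r$) and covering radius $R$, where the covering radius of a code $C\subseteq\mathbb F_q^n$ is the least integer $\rho$ such that every vector of $\mathbb F_q^n$ is at Hamming distance at most $\rho$ from some codeword of $C$. Let $N=2t-2$, where $t=4$, $t=6$ or $t\ge 8$ (equivalently, $N\ge 6$ is even and $N\ne 8,12$). Then for every prime power $q\ge 79$, $$s(N,q)=\ell(2,N+1,q)\le\left(2\sqrt{(q+1)\ln(q+1)}+2\right)q^{\frac{N-2}{2}}+2q^{\frac{N-4}{2}}.$$ Moreover, for each such fixed $N$, the right-hand side is asymptotically equivalent to $2q^{\frac{N-1}{2}}\sqrt{\ln q}$ as $q\to\infty$. -/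

import Mathlib

open scoped LinearAlgebra.Projectivization

/-- A set `S` of points of a projective space is saturating if every point outside `S` is
collinear with two (distinct) points of `S`. -/
def IsSaturating {F V : Type*} [Field F] [AddCommGroup V] [Module F V]
    (S : Set (ℙ F V)) : Prop :=
  ∀ P : ℙ F V, P ∉ S → ∃ A ∈ S, ∃ B ∈ S, A ≠ B ∧
    Projectivization.IsCollinear ({P, A, B} : Set (ℙ F V))

/-- The sizes of the saturating sets in the projective space `PG(N, F)`, the space of
one-dimensional subspaces of `F ^ (N + 1)`. -/
def saturatingSizes (F : Type*) [Field F] (N : ℕ) : Set ℕ :=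
  {k | ∃ S : Finset (ℙ F (Fin (N + 1) → F)),
    IsSaturating (S : Set (ℙ F (Fin (N + 1) → F))) ∧ S.card = k}

/-- `s(N, q)`: the smallest size of a saturating set in `PG(N, F)`, where `F` has `q` elements. -/
noncomputable def smallestSaturatingSize (F : Type*) [Field F] (N : ℕ) : ℕ :=
  sInf (saturatingSizes F N)

/-- The covering radius of a linear code `C ⊆ F ^ n`: the least `ρ` such that the Hamming balls of
radius `ρ` around the codewords cover `F ^ n`. -/
noncomputable def coveringRadius {F : Type*} [Field F] [DecidableEq F] {n : ℕ}
    (C : Submodule F (Fin n → F)) : ℕ :=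
  sInf {ρ : ℕ | ∀ x : Fin n → F, ∃ c ∈ C, hammingDist x c ≤ ρ}

/-- The lengths `n` of the linear codes over `F` with covering radius (exactly) `R` and
codimension `r`, that is, of the `[n, n - r]_q R` codes. -/
def coveringCodeLengths (F : Type*) [Field F] [DecidableEq F] (R r : ℕ) : Set ℕ :=
  {n | ∃ C : Submodule F (Fin n → F), Module.finrank F C + r = n ∧ coveringRadius C = R}

/-- The length function `ℓ(R, r, q)`: the smallest length of a linear code over the field `F`
with `q` elements that has covering radius `R` and codimension `r`. -/
noncomputable def lengthFunction (F : Type*) [Field F] [DecidableEq F] (R r : ℕ) : ℕ :=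
  sInf (coveringCodeLengths F R r)

/-- The real number
`(2 √((q + 1) ln (q + 1)) + 2) q ^ ((N - 2) / 2) + 2 q ^ ((N - 4) / 2)`. -/
noncomputable def saturatingBound (N q : ℕ) : ℝ :=
  (2 * Real.sqrt (((q : ℝ) + 1) * Real.log ((q : ℝ) + 1)) + 2) * (q : ℝ) ^ (((N : ℝ) - 2) / 2)
    + 2 * (q : ℝ) ^ (((N : ℝ) - 4) / 2)

/-!
The upper bound is proved by working with finite sets `T` of vectors such that every vector is a
linear combination of two elements of `T` (`pairSpan F T = Set.univ`); the points represented by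
such a `T` form a saturating set, and they are the columns of a parity check matrix of a code whose
covering radius is at most two.

*The plane.* In `F ^ 3`, choose vectors greedily. If `u` is not yet a combination of two of the `k`
chosen vectors, which are pairwise non-proportional, then the `k (q - 1) ^ 2` vectors `c u + d a`
(`a` chosen, `c, d ≠ 0`) are distinct and each of them would make `u` such a combination. Averaging
over all `q ^ 3` vectors, some choice multiplies the number of uncovered vectors by at most
`exp (-k (q - 1) ^ 2 / q ^ 3)` (`exists_insert_card_compl_le`). The uncovered vectors are closed
under nonzero scalars, so they have disappeared once their number is less than `q - 1`. For
`q ≥ 79` this takes at most `2 √((q + 1) ln (q + 1)) + 19 / 10` vectors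
(`exists_pairSpan_eq_univ_three`), slightly fewer than the bound allows.

*The lift.* For `W = F ^ m`, attach distinct scalars `β h` to the elements `h` of the planar set,
which has at most `q` elements. The vectors `(h, x, β h • x)` with `x ∈ W`, together with
representatives of the points of the two summands `W`, span `F ^ 3 × W × W` by pairs
(`exists_pairSpan_prod_eq_univ`). The slack `q ^ m / 10` left by the planar set exceeds the
`2 (q ^ m - 1) / (q - 1)` additional vectors. With `m = (N - 2) / 2` this is the upper bound,
without its last term.

*Saturating sets and codes.* The columns of a parity check matrix of a code of covering radius two
contain a saturating set. Conversely the representatives of a smallest saturating set are the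
columns of a parity check matrix of a code with covering radius at most two, and the radius is
exactly two: otherwise the set would consist of all the points, but all points except one already
form a saturating set (`isSaturating_compl_singleton`). Hence the two minima agree.
-/

/-! ### Pairs of vectors spanning the whole space -/

/-- The vectors that are a linear combination of two (possibly equal) elements of `T`. -/
def pairSpan (F : Type*) {V : Type*} [Field F] [AddCommGroup V] [Module F V] (T : Finset V) :
    Set V :=
  {v | ∃ a ∈ T, ∃ b ∈ T, ∃ c d : F, v = c • a + d • b}

/-- The elements of `T` are nonzero and pairwise non-proportional. -/
def PairwiseNonproportional (F : Type*) {V : Type*} [Field F] [AddCommGroup V] [Module F V]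
    (T : Finset V) : Prop :=
  (0 : V) ∉ T ∧ ∀ a ∈ T, ∀ b ∈ T, ∀ c d : F, c ≠ 0 → c • a = d • b → a = b

section Basic

variable {F V : Type*} [Field F] [AddCommGroup V] [Module F V]

theorem smul_mem_pairSpan {T : Finset V} {v : V} (hv : v ∈ pairSpan F T) (c : F) :
    c • v ∈ pairSpan F T := by
  obtain ⟨a, ha, b, hb, x, y, rfl⟩ := hv
  exact ⟨a, ha, b, hb, c * x, c * y, by rw [smul_add, smul_smul, smul_smul]⟩

theorem smul_mem_pairSpan_iff {T : Finset V} {v : V} {c : F} (hc : c ≠ 0) :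
    c • v ∈ pairSpan F T ↔ v ∈ pairSpan F T := by
  refine ⟨fun h => ?_, fun h => smul_mem_pairSpan h c⟩
  simpa [smul_smul, inv_mul_cancel₀ hc] using smul_mem_pairSpan h c⁻¹

theorem pairSpan_mono {S T : Finset V} (h : S ⊆ T) : pairSpan F S ⊆ pairSpan F T :=
  fun _ ⟨a, ha, b, hb, c, d, e⟩ => ⟨a, h ha, b, h hb, c, d, e⟩

/-- Transport along a linear equivalence. -/
theorem exists_pairSpan_eq_univ_of_linearEquiv {V' : Type*} [AddCommGroup V'] [Module F V']
    (e : V ≃ₗ[F] V') {T : Finset V} (hT : pairSpan F T = Set.univ) :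
    ∃ T' : Finset V', pairSpan F T' = Set.univ ∧ T'.card = T.card := by
  refine ⟨T.map e.toEquiv.toEmbedding, Set.eq_univ_of_forall fun v => ?_, T.card_map _⟩
  obtain ⟨a, ha, b, hb, c, d, h⟩ : e.symm v ∈ pairSpan F T := hT ▸ Set.mem_univ _
  refine ⟨e a, by simpa using ha, e b, by simpa using hb, c, d, ?_⟩
  rw [← map_smul, ← map_smul, ← map_add, ← h, e.apply_symm_apply]

end Basic

/-! ### The greedy construction -/

section Greedy

variable {F V : Type*} [Field F] [Fintype F] [AddCommGroup V] [Module F V] [Fintype V]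

open Classical in
/-- If `u` is not yet spanned by a pair from `T`, all the vectors `c • u + d • a` with `a ∈ T` and
`c`, `d` nonzero are distinct, and adjoining any of them to `T` makes `u` spanned by a pair. -/
theorem card_mul_sq_le_card_completing {T : Finset V} (hT : PairwiseNonproportional F T) {u : V}
    (hu : u ∉ pairSpan F T) :
    T.card * (Fintype.card F - 1) ^ 2 ≤
      (Finset.univ.filter fun P : V => ∃ a ∈ T, ∃ c d : F, u = c • a + d • P).card := by
  have hcard : T.card * (Fintype.card F - 1) ^ 2 =
      (T ×ˢ (Finset.univ : Finset (Fˣ × Fˣ))).card := by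
    rw [Finset.card_product, Finset.card_univ, Fintype.card_prod, Fintype.card_units, sq]
  rw [hcard]
  refine Finset.card_le_card_of_injOn
    (fun p => (p.2.1 : F) • u + (p.2.2 : F) • p.1) ?_ ?_
  · rintro ⟨a, c, d⟩ h
    have ha : a ∈ T := (Finset.mem_product.1 h).1
    simp only [Finset.coe_filter, Finset.mem_univ, true_and, Set.mem_ofPred_eq]
    refine ⟨a, ha, -((c : F)⁻¹ * d), (c : F)⁻¹, ?_⟩
    rw [smul_add, smul_smul, smul_smul, inv_mul_cancel₀ c.ne_zero, one_smul, neg_smul]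
    abel
  · rintro ⟨a, c, d⟩ h ⟨a', c', d'⟩ h' heq
    have ha : a ∈ T := (Finset.mem_product.1 h).1
    have ha' : a' ∈ T := (Finset.mem_product.1 h').1
    simp only at heq
    have hc : (c : F) = c' := by
      by_contra hne
      apply hu
      rw [← smul_mem_pairSpan_iff (sub_ne_zero.2 hne)]
      refine ⟨a', ha', a, ha, d', -d, ?_⟩
      rw [sub_smul, neg_smul, ← sub_eq_add_neg, sub_eq_sub_iff_add_eq_add, heq]
      abel
    rw [hc, add_right_inj] at heq
    obtain rfl := hT.2 a ha a' ha' d d' d.ne_zero heq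
    have ha0 : a ≠ 0 := fun h0 => hT.1 (h0 ▸ ha)
    have hd : (d : F) = d' := smul_left_injective F ha0 heq
    rw [Units.ext hc, Units.ext hd]

open Classical in
/-- One greedy step: averaging the previous count over all vectors `P` yields one that, when
adjoined, reduces the set of vectors not spanned by a pair by a definite factor. -/
theorem exists_insert_card_compl_le {T : Finset V} (hT : PairwiseNonproportional F T)
    (hne : T.Nonempty) (hcov : pairSpan F T ≠ Set.univ) :
    ∃ T' : Finset V, PairwiseNonproportional F T' ∧ T'.card = T.card + 1 ∧
      ((Finset.univ.filter fun v => v ∉ pairSpan F T').card : ℝ) ≤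
        (Finset.univ.filter fun v => v ∉ pairSpan F T).card *
          Real.exp (-(T.card * (((Fintype.card F : ℝ) - 1) ^ 2 / Fintype.card V))) := by
  set U := Finset.univ.filter fun v => v ∉ pairSpan F T with hU
  set R : V → V → Prop := fun u P => ∃ a ∈ T, ∃ c d : F, u = c • a + d • P with hR
  have hUne : U.Nonempty := by
    obtain ⟨v, hv⟩ := (Set.ne_univ_iff_exists_notMem _).1 hcov
    exact ⟨v, by simpa [hU] using hv⟩
  have hq : 1 < Fintype.card F := Fintype.one_lt_card
  have hq' : (1 : ℝ) < Fintype.card F := by exact_mod_cast hq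
  have hV : (0 : ℝ) < Fintype.card V := by exact_mod_cast Fintype.card_pos
  have hdouble : U.card * (T.card * (Fintype.card F - 1) ^ 2) ≤
      ∑ P : V, (U.filter fun u => R u P).card := by
    have := Finset.sum_card_bipartiteAbove_eq_sum_card_bipartiteBelow (s := U)
      (t := (Finset.univ : Finset V)) R
    simp only [Finset.bipartiteAbove, Finset.bipartiteBelow] at this
    rw [← this, ← smul_eq_mul]
    refine Finset.card_nsmul_le_sum _ _ _ fun u hu => ?_
    exact card_mul_sq_le_card_completing hT (by simpa [hU] using hu)
  obtain ⟨P, hP⟩ : ∃ P : V, (U.card : ℝ) * (T.card * ((Fintype.card F : ℝ) - 1) ^ 2) ≤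
      (U.filter fun u => R u P).card * Fintype.card V := by
    by_contra! hcon
    have hlt : ∑ P : V, ((U.filter fun u => R u P).card : ℝ) * Fintype.card V <
        ∑ _P : V, (U.card : ℝ) * (T.card * ((Fintype.card F : ℝ) - 1) ^ 2) :=
      Finset.sum_lt_sum_of_nonempty Finset.univ_nonempty fun P _ => hcon P
    rw [← Finset.sum_mul, Finset.sum_const, Finset.card_univ, nsmul_eq_mul, mul_comm,
      mul_lt_mul_iff_right₀ hV] at hlt
    have hd : ((U.card * (T.card * (Fintype.card F - 1) ^ 2) : ℕ) : ℝ) ≤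
        ((∑ P : V, (U.filter fun u => R u P).card : ℕ) : ℝ) := by exact_mod_cast hdouble
    push_cast [Nat.cast_sub hq.le] at hd
    linarith
  have hTpos : (0 : ℝ) < T.card := by exact_mod_cast hne.card_pos
  have hUpos : (0 : ℝ) < U.card := by exact_mod_cast hUne.card_pos
  have hRpos : 0 < (U.filter fun u => R u P).card := by
    have h1 : 0 < (U.card : ℝ) * (T.card * ((Fintype.card F : ℝ) - 1) ^ 2) := by
      have : 0 < (Fintype.card F : ℝ) - 1 := by linarith
      positivity
    have h2 := lt_of_lt_of_le h1 hP
    exact_mod_cast pos_of_mul_pos_left h2 hV.le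
  obtain ⟨u, hu⟩ := Finset.card_pos.1 hRpos
  obtain ⟨huU, a₀, ha₀, c₀, d₀, hu₀⟩ := Finset.mem_filter.1 hu
  replace huU : u ∉ pairSpan F T := by simpa [hU] using huU
  -- `P` is not proportional to an element of `T`, since it makes `u` newly spanned.
  have hPT : ∀ a ∈ T, ∀ d : F, P ≠ d • a := by
    rintro a ha d rfl
    exact huU ⟨a₀, ha₀, a, ha, c₀, d₀ * d, by rw [hu₀, smul_smul]⟩
  have hP0 : P ≠ 0 := fun h => hPT a₀ ha₀ 0 (by rw [h, zero_smul])
  have hPnot : P ∉ T := fun h => hPT P h 1 (one_smul F P).symm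
  refine ⟨insert P T, ⟨?_, ?_⟩, Finset.card_insert_of_notMem hPnot, ?_⟩
  · rw [Finset.mem_insert, not_or]
    exact ⟨hP0.symm, hT.1⟩
  · intro a ha b hb c d hc h
    rcases Finset.mem_insert.1 ha with rfl | haT <;> rcases Finset.mem_insert.1 hb with rfl | hbT
    · rfl
    · refine absurd ?_ (hPT b hbT (c⁻¹ * d))
      rw [mul_smul, ← h, smul_smul, inv_mul_cancel₀ hc, one_smul]
    · by_cases hd : d = 0
      · rw [hd, zero_smul, smul_eq_zero] at h
        rcases h with h | h
        · exact absurd h hc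
        · exact absurd (h ▸ haT) hT.1
      · refine absurd ?_ (hPT a haT (d⁻¹ * c))
        rw [mul_smul, h, smul_smul, inv_mul_cancel₀ hd, one_smul]
    · exact hT.2 a haT b hbT c d hc h
  · have hsub : (Finset.univ.filter fun v => v ∉ pairSpan F (insert P T)) ⊆
        U.filter fun u => ¬ R u P := by
      intro v hv
      simp only [Finset.mem_filter, Finset.mem_univ, true_and, hU] at hv ⊢
      refine ⟨fun h => hv (pairSpan_mono (Finset.subset_insert _ _) h), ?_⟩
      rintro ⟨a, ha, c, d, rfl⟩
      exact hv ⟨a, Finset.mem_insert_of_mem ha, P, Finset.mem_insert_self _ _, c, d, rfl⟩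
    have hle : ((Finset.univ.filter fun v => v ∉ pairSpan F (insert P T)).card : ℝ) ≤
        (U.filter fun u => ¬ R u P).card := by exact_mod_cast Finset.card_le_card hsub
    have hsplit : ((U.filter fun u => R u P).card : ℝ) + (U.filter fun u => ¬ R u P).card =
        U.card := by exact_mod_cast Finset.card_filter_add_card_filter_not (s := U) fun u => R u P
    have hexp := Real.add_one_le_exp
      (-(T.card * (((Fintype.card F : ℝ) - 1) ^ 2 / Fintype.card V)))
    have hfrac : (U.card : ℝ) * (T.card * (((Fintype.card F : ℝ) - 1) ^ 2 / Fintype.card V)) ≤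
        (U.filter fun u => R u P).card := by
      rw [← mul_div_assoc, ← mul_div_assoc, div_le_iff₀ hV]
      exact hP
    nlinarith [mul_le_mul_of_nonneg_left hexp hUpos.le]

open Classical in
/-- Iterating the greedy step from a single vector: after `k` steps at most
`|V| * exp (-(1 + ⋯ + k) (q - 1) ^ 2 / |V|)` vectors remain. -/
theorem exists_card_compl_pairSpan_le [Nontrivial V] (k : ℕ) :
    ∃ T : Finset V, T.Nonempty ∧ T.card ≤ k + 1 ∧
      (pairSpan F T = Set.univ ∨ PairwiseNonproportional F T ∧ T.card = k + 1 ∧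
        ((Finset.univ.filter fun v => v ∉ pairSpan F T).card : ℝ) ≤ Fintype.card V *
          Real.exp (-((k : ℝ) * (k + 1) / 2 *
            (((Fintype.card F : ℝ) - 1) ^ 2 / Fintype.card V)))) := by
  induction k with
  | zero =>
    obtain ⟨a, ha⟩ := exists_ne (0 : V)
    refine ⟨{a}, Finset.singleton_nonempty a, by simp, Or.inr ⟨⟨by simpa using ha.symm, ?_⟩,
      by simp, ?_⟩⟩
    · intro b hb c hc _ _ _ _
      rw [Finset.mem_singleton.1 hb, Finset.mem_singleton.1 hc]
    · simpa using Finset.card_le_univ (Finset.univ.filter fun v => v ∉ pairSpan F ({a} : Finset V))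
  | succ k ih =>
    obtain ⟨T, hne, hle, h⟩ := ih
    by_cases hcov : pairSpan F T = Set.univ
    · exact ⟨T, hne, by omega, Or.inl hcov⟩
    obtain ⟨hT, hcard, hU⟩ := h.resolve_left hcov
    obtain ⟨T', hT', hcard', hU'⟩ := exists_insert_card_compl_le hT hne hcov
    refine ⟨T', Finset.card_pos.1 (by omega), by omega, Or.inr ⟨hT', by omega, ?_⟩⟩
    refine hU'.trans ((mul_le_mul_of_nonneg_right hU (Real.exp_pos _).le).trans_eq ?_)
    rw [mul_assoc, ← Real.exp_add, hcard]
    congr 2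
    push_cast
    ring

open Classical in
/-- The set of vectors not spanned by a pair is closed under nonzero scalars, so it is empty as soon
as it has fewer than `q - 1` elements. -/
theorem exists_pairSpan_eq_univ_of_exp_lt [Nontrivial V] (k : ℕ)
    (hk : Fintype.card V * Real.exp (-((k : ℝ) * (k + 1) / 2 *
      (((Fintype.card F : ℝ) - 1) ^ 2 / Fintype.card V))) < (Fintype.card F : ℝ) - 1) :
    ∃ T : Finset V, pairSpan F T = Set.univ ∧ T.card ≤ k + 1 := by
  obtain ⟨T, hne, hcard, h⟩ := exists_card_compl_pairSpan_le (F := F) (V := V) k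
  refine ⟨T, ?_, hcard⟩
  by_contra hcov
  obtain ⟨-, -, hU⟩ := h.resolve_left hcov
  obtain ⟨u, hu⟩ := (Set.ne_univ_iff_exists_notMem _).1 hcov
  have hu0 : u ≠ 0 := by
    rintro rfl
    obtain ⟨a, ha⟩ := hne
    exact hu ⟨a, ha, a, ha, 0, 0, by simp⟩
  have hle : (Finset.univ : Finset Fˣ).card ≤
      (Finset.univ.filter fun v => v ∉ pairSpan F T).card := by
    refine Finset.card_le_card_of_injOn (fun c => (c : F) • u) (fun c _ => ?_) ?_
    · simpa [smul_mem_pairSpan_iff c.ne_zero] using hu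
    · intro c _ d _ hcd
      exact Units.ext (smul_left_injective F hu0 hcd)
  rw [Finset.card_univ, Fintype.card_units] at hle
  have hle' : ((Fintype.card F - 1 : ℕ) : ℝ) ≤
      (Finset.univ.filter fun v => v ∉ pairSpan F T).card := by exact_mod_cast hle
  rw [Nat.cast_sub Fintype.card_pos, Nat.cast_one] at hle'
  linarith

end Greedy

/-! ### The size of the planar set -/

theorem log_add_one_le_div_sixteen {q : ℝ} (hq : 79 ≤ q) : Real.log (q + 1) ≤ (q + 1) / 16 := by
  have h1 : Real.log ((q + 1) / 32) ≤ (q + 1) / 32 - 1 :=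
    Real.log_le_sub_one_of_pos (by linarith)
  have h2 : Real.log (32 : ℝ) = 5 * Real.log 2 := by
    rw [show (32 : ℝ) = 2 ^ 5 by norm_num, Real.log_pow]
    norm_num
  rw [Real.log_div (by linarith) (by norm_num), h2] at h1
  linarith [Real.log_two_lt_d9]

theorem two_mul_sqrt_mul_log_le {q : ℝ} (hq : 79 ≤ q) :
    2 * √((q + 1) * Real.log (q + 1)) ≤ (q + 1) / 2 := by
  have h : √((q + 1) * Real.log (q + 1)) ≤ (q + 1) / 4 := by
    rw [Real.sqrt_le_left (by linarith)]
    nlinarith [log_add_one_le_div_sixteen hq]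
  linarith

/-- Once `k` exceeds `2 √((q + 1) ln (q + 1)) - 1 / 10`, fewer than `q - 1` vectors of a
three-dimensional space survive `k` greedy steps. -/
theorem cube_mul_exp_lt {q k : ℝ} (hq : 79 ≤ q)
    (hk : 2 * √((q + 1) * Real.log (q + 1)) - 1 / 10 < k) :
    q ^ 3 * Real.exp (-(k * (k + 1) / 2 * ((q - 1) ^ 2 / q ^ 3))) < q - 1 := by
  set L := Real.log (q + 1) with hL
  set s := √((q + 1) * L) with hs
  have hL1 : 1 ≤ L := by
    rw [hL, Real.le_log_iff_exp_le (by linarith)]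
    linarith [Real.exp_one_lt_d9]
  have hs2 : s ^ 2 = (q + 1) * L := Real.sq_sqrt (by nlinarith)
  have hs4 : 4 * L ≤ s := by
    refine Real.le_sqrt_of_sq_le ?_
    nlinarith [log_add_one_le_div_sixteen hq]
  have hkk : 4 * s ^ 2 + 8 / 5 * s - 9 / 100 < k * (k + 1) := by nlinarith
  have hlog : Real.log q ≤ L := Real.log_le_log (by linarith) (by linarith)
  have hlog' : Real.log q - Real.log (q - 1) ≤ 1 / (q - 1) := by
    rw [← Real.log_div (by linarith) (by linarith)]
    refine (Real.log_le_sub_one_of_pos (div_pos (by linarith) (by linarith))).trans_eq ?_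
    have : q - 1 ≠ 0 := by linarith
    field_simp
    ring
  have hq3 : 0 < q ^ 3 := by positivity
  have hq1 : 0 < q - 1 := by linarith
  -- `q ^ 3 / (q - 1) ^ 2 = q + 2 + O(1 / q)`, and the linear term `8 s / 5` absorbs the excess over
  -- `q + 1`.
  have hden : q ^ 3 ≤ (q + 51 / 25) * (q - 1) ^ 2 := by nlinarith
  have hsmall : (q + 51 / 25) * (1 / (q - 1)) ≤ 26 / 25 := by
    rw [mul_one_div, div_le_iff₀ hq1]
    linarith
  have hmain : (q + 51 / 25) * (2 * L + 1 / (q - 1)) < k * (k + 1) / 2 := by nlinarith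
  have hexp : 2 * L + 1 / (q - 1) < k * (k + 1) / 2 * ((q - 1) ^ 2 / q ^ 3) := by
    rw [← mul_div_assoc, lt_div_iff₀ hq3]
    have hpos : 0 < 2 * L + 1 / (q - 1) := by positivity
    calc (2 * L + 1 / (q - 1)) * q ^ 3
        ≤ (2 * L + 1 / (q - 1)) * ((q + 51 / 25) * (q - 1) ^ 2) :=
          mul_le_mul_of_nonneg_left hden hpos.le
      _ = (q + 51 / 25) * (2 * L + 1 / (q - 1)) * (q - 1) ^ 2 := by ring
      _ < k * (k + 1) / 2 * (q - 1) ^ 2 := mul_lt_mul_of_pos_right hmain (by positivity)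
  have hlog3 : Real.log (q ^ 3) = 3 * Real.log q := by
    rw [Real.log_pow]
    norm_num
  calc q ^ 3 * Real.exp (-(k * (k + 1) / 2 * ((q - 1) ^ 2 / q ^ 3)))
      = Real.exp (3 * Real.log q - k * (k + 1) / 2 * ((q - 1) ^ 2 / q ^ 3)) := by
        rw [Real.exp_sub, ← hlog3, Real.exp_log hq3, Real.exp_neg, ← div_eq_mul_inv]
    _ < q - 1 := by
        rw [← Real.lt_log_iff_exp_lt hq1]
        linarith

theorem exists_pairSpan_eq_univ_three (F : Type*) [Field F] [Fintype F]
    (hq : 79 ≤ Fintype.card F) :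
    ∃ T : Finset (Fin 3 → F), pairSpan F T = Set.univ ∧
      (T.card : ℝ) ≤ 2 * √(((Fintype.card F : ℝ) + 1) * Real.log ((Fintype.card F : ℝ) + 1))
        + 19 / 10 := by
  classical
  have hq' : (79 : ℝ) ≤ Fintype.card F := by exact_mod_cast hq
  set s := √(((Fintype.card F : ℝ) + 1) * Real.log ((Fintype.card F : ℝ) + 1)) with hs
  have hs0 : 0 ≤ s := Real.sqrt_nonneg _
  have h1 := Nat.lt_floor_add_one (2 * s + 9 / 10)
  have h2 := Nat.floor_le (show 0 ≤ 2 * s + 9 / 10 by positivity)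
  obtain ⟨T, hT, hcard⟩ := exists_pairSpan_eq_univ_of_exp_lt (F := F) (V := Fin 3 → F)
    ⌊2 * s + 9 / 10⌋₊ (by
      have hV : (Fintype.card (Fin 3 → F) : ℝ) = (Fintype.card F : ℝ) ^ 3 := by simp
      rw [hV]
      exact cube_mul_exp_lt hq' (by linarith))
  refine ⟨T, hT, ?_⟩
  have hcard' : (T.card : ℝ) ≤ ⌊2 * s + 9 / 10⌋₊ + 1 := by exact_mod_cast hcard
  linarith

/-! ### Lifting to higher dimension -/

open Classical in
/-- If `h` runs through a set `T` as in the hypothesis and `β` attaches distinct scalars to its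
elements, the vectors `(h, x, β h • x)` together with representatives of the points of the two
summands `W` span everything by pairs: for a combination of two different `h` one solves a linear
system with determinant a multiple of the difference of the scalars, and for a multiple of a single
`h` the missing vector lies in the last summand. -/
theorem exists_pairSpan_prod_eq_univ {F V W : Type*} [Field F] [Fintype F] [AddCommGroup V]
    [Module F V] [AddCommGroup W] [Module F W] [Fintype W] {T : Finset V}
    (hT : pairSpan F T = Set.univ) (hcard : T.card ≤ Fintype.card F) {E : Finset W}
    (hE : ∀ w : W, ∃ e ∈ E, ∃ c : F, w = c • e) :
    ∃ T' : Finset (V × W × W), pairSpan F T' = Set.univ ∧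
      T'.card ≤ T.card * Fintype.card W + 2 * E.card := by
  obtain ⟨β, hβ⟩ : ∃ β : V → F, Set.InjOn β T := by
    have hc : T.card ≤ (Finset.univ : Finset F).card := by simpa using hcard
    rw [← Fintype.card_coe, Finset.card_univ] at hc
    obtain ⟨f⟩ := Function.Embedding.nonempty_of_card_le hc
    refine ⟨fun v => if h : v ∈ T then f ⟨v, h⟩ else 0, fun a ha b hb hab => ?_⟩
    have ha' : a ∈ T := ha
    have hb' : b ∈ T := hb
    simp only [ha', hb', dif_pos] at hab
    exact congrArg Subtype.val (f.injective hab)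
  set A : Finset (V × W × W) :=
    (T ×ˢ (Finset.univ : Finset W)).image fun p => (p.1, p.2, β p.1 • p.2) with hA
  set B : Finset (V × W × W) := E.image fun e => (0, e, 0) with hB
  set C : Finset (V × W × W) := E.image fun e => (0, 0, e) with hC
  have memA : ∀ h ∈ T, ∀ x : W, (h, x, β h • x) ∈ A ∪ B ∪ C := fun h hh x =>
    Finset.mem_union_left _ (Finset.mem_union_left _
      (Finset.mem_image.2 ⟨(h, x), by simpa using hh, rfl⟩))
  have memB : ∀ e ∈ E, ((0, e, 0) : V × W × W) ∈ A ∪ B ∪ C := fun e he =>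
    Finset.mem_union_left _ (Finset.mem_union_right _ (Finset.mem_image_of_mem _ he))
  have memC : ∀ e ∈ E, ((0, 0, e) : V × W × W) ∈ A ∪ B ∪ C := fun e he =>
    Finset.mem_union_right _ (Finset.mem_image_of_mem _ he)
  refine ⟨A ∪ B ∪ C, Set.eq_univ_of_forall ?_, ?_⟩
  · rintro ⟨v, b, w⟩
    have single : ∀ h ∈ T, ∀ c : F, c ≠ 0 → v = c • h →
        ((v, b, w) : V × W × W) ∈ pairSpan F (A ∪ B ∪ C) := by
      rintro h hh c hc rfl
      obtain ⟨e, he, z, hz⟩ := hE (w - β h • b)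
      refine ⟨_, memA h hh (c⁻¹ • b), _, memC e he, c, z, ?_⟩
      simp only [Prod.smul_mk, Prod.mk_add_mk, smul_zero, add_zero, Prod.mk.injEq, true_and]
      refine ⟨by rw [smul_smul, mul_inv_cancel₀ hc, one_smul], ?_⟩
      rw [← hz, smul_comm c, smul_smul c, mul_inv_cancel₀ hc, one_smul]
      abel
    obtain ⟨g, hg, h, hh, c, d, hv⟩ : v ∈ pairSpan F T := hT ▸ Set.mem_univ v
    by_cases hv0 : v = 0
    · obtain ⟨e, he, y, hy⟩ := hE b
      obtain ⟨e', he', z, hz⟩ := hE w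
      exact ⟨_, memB e he, _, memC e' he', y, z, by simp [hv0, hy, hz]⟩
    by_cases hc : c = 0
    · refine single h hh d ?_ (by rw [hv, hc, zero_smul, zero_add])
      rintro rfl
      exact hv0 (by simp [hv, hc])
    by_cases hd : d = 0
    · exact single g hg c hc (by rw [hv, hd, zero_smul, add_zero])
    by_cases hgh : g = h
    · subst hgh
      have hv' : v = (c + d) • g := by rw [hv, add_smul]
      refine single g hg (c + d) (fun h0 => hv0 ?_) hv'
      rw [hv', h0, zero_smul]
    have hdet : β h - β g ≠ 0 := sub_ne_zero.2 fun h0 => hgh (hβ hg hh h0.symm)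
    -- The solution of `c x + d y = b`, `c (β g) x + d (β h) y = w`.
    set y : W := (d * (β h - β g))⁻¹ • (w - β g • b) with hy
    set x : W := c⁻¹ • (b - d • y) with hx
    have hcx : c • x = b - d • y := by rw [hx, smul_smul, mul_inv_cancel₀ hc, one_smul]
    have hdy : (β h - β g) • d • y = w - β g • b := by
      rw [hy, smul_smul, smul_smul, mul_comm (β h - β g) d,
        mul_inv_cancel₀ (mul_ne_zero hd hdet), one_smul]
    refine ⟨_, memA g hg x, _, memA h hh y, c, d, ?_⟩
    simp only [Prod.smul_mk, Prod.mk_add_mk, Prod.mk.injEq]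
    refine ⟨hv, by rw [hcx]; abel, ?_⟩
    rw [smul_comm c, smul_comm d, hcx]
    rw [sub_smul, sub_eq_iff_eq_add] at hdy
    rw [hdy, smul_sub]
    abel
  · refine (Finset.card_union_le _ _).trans ?_
    have h1 : A.card ≤ T.card * Fintype.card W := by
      refine Finset.card_image_le.trans_eq ?_
      rw [Finset.card_product, Finset.card_univ]
    have h2 : B.card ≤ E.card := Finset.card_image_le
    have h3 : C.card ≤ E.card := Finset.card_image_le
    have h4 := Finset.card_union_le A B
    omega

/-- Representatives of the points of the projective space of a nontrivial `W`. -/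
theorem exists_projective_representatives (F W : Type*) [Field F] [Fintype F] [AddCommGroup W]
    [Module F W] [Fintype W] [Nontrivial W] :
    ∃ E : Finset W, (∀ w : W, ∃ e ∈ E, ∃ c : F, w = c • e) ∧
      E.card * (Fintype.card F - 1) < Fintype.card W := by
  classical
  have : Fintype (ℙ F W) := Fintype.ofFinite _
  refine ⟨Finset.univ.image fun P : ℙ F W => P.rep, fun w => ?_, ?_⟩
  · by_cases hw : w = 0
    · obtain ⟨v, hv⟩ := exists_ne (0 : W)
      exact ⟨_, Finset.mem_image_of_mem _ (Finset.mem_univ (Projectivization.mk F v hv)), 0,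
        by rw [hw, zero_smul]⟩
    · refine ⟨_, Finset.mem_image_of_mem _ (Finset.mem_univ (Projectivization.mk F w hw)), ?_⟩
      obtain ⟨a, ha⟩ := Projectivization.exists_smul_eq_mk_rep F w hw
      refine ⟨(a⁻¹ : Fˣ), ?_⟩
      rw [← ha]
      exact (inv_smul_smul a w).symm
  · have h := Projectivization.card' F W
    simp only [Nat.card_eq_fintype_card] at h
    have hle : (Finset.univ.image fun P : ℙ F W => P.rep).card ≤ Fintype.card (ℙ F W) :=
      Finset.card_image_le
    rw [h]
    exact Nat.lt_succ_of_le (Nat.mul_le_mul_right _ hle)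

/-- The lift of the planar construction to dimension `3 + 2 m`. The scalars `F` suffice for the
lift, as the planar set has at most `q` elements, and the slack in its size pays for the
representatives of the points of the two summands. -/
theorem exists_pairSpan_eq_univ_odd (F : Type*) [Field F] [Fintype F]
    (hq : 79 ≤ Fintype.card F) {n m : ℕ} (hm : 0 < m) (hn : n = 3 + 2 * m) :
    ∃ T : Finset (Fin n → F), pairSpan F T = Set.univ ∧
      (T.card : ℝ) ≤
        (2 * √(((Fintype.card F : ℝ) + 1) * Real.log ((Fintype.card F : ℝ) + 1)) + 2)
          * (Fintype.card F : ℝ) ^ m := by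
  classical
  have hq' : (79 : ℝ) ≤ Fintype.card F := by exact_mod_cast hq
  have : Nonempty (Fin m) := ⟨⟨0, hm⟩⟩
  obtain ⟨T, hT, hTcard⟩ := exists_pairSpan_eq_univ_three F hq
  obtain ⟨E, hE, hEcard⟩ := exists_projective_representatives F (Fin m → F)
  have hTq : T.card ≤ Fintype.card F := by
    have := two_mul_sqrt_mul_log_le hq'
    have h : (T.card : ℝ) ≤ Fintype.card F := by linarith
    exact_mod_cast h
  obtain ⟨T', hT', hT'card⟩ := exists_pairSpan_prod_eq_univ hT hTq hE
  have e : ((Fin 3 → F) × (Fin m → F) × (Fin m → F)) ≃ₗ[F] (Fin n → F) :=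
    LinearEquiv.ofFinrankEq _ _ (by simp [hn]; ring)
  obtain ⟨T'', hT'', hcard⟩ := exists_pairSpan_eq_univ_of_linearEquiv e hT'
  refine ⟨T'', hT'', ?_⟩
  have hW : Fintype.card (Fin m → F) = Fintype.card F ^ m := by simp
  rw [hW] at hEcard hT'card
  have h1 : (T''.card : ℝ) ≤ T.card * (Fintype.card F : ℝ) ^ m + 2 * E.card := by
    rw [hcard]
    exact_mod_cast hT'card
  have h2 : (E.card : ℝ) * ((Fintype.card F : ℝ) - 1) ≤ (Fintype.card F : ℝ) ^ m := by
    have : ((E.card * (Fintype.card F - 1) : ℕ) : ℝ) ≤ ((Fintype.card F ^ m : ℕ) : ℝ) := by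
      exact_mod_cast hEcard.le
    rwa [Nat.cast_mul, Nat.cast_sub (by omega), Nat.cast_one, Nat.cast_pow] at this
  have h3 : (E.card : ℝ) * 78 ≤ (E.card : ℝ) * ((Fintype.card F : ℝ) - 1) :=
    mul_le_mul_of_nonneg_left (by linarith) (Nat.cast_nonneg _)
  have h4 := mul_le_mul_of_nonneg_right hTcard
    (show 0 ≤ (Fintype.card F : ℝ) ^ m by positivity)
  linarith

/-! ### Saturating sets and pairs of vectors -/

section Saturating

variable {F V : Type*} [Field F] [AddCommGroup V] [Module F V]

theorem isCollinear_triple_of_rep_eq {P : ℙ F V} {a b : V} (ha : a ≠ 0) (hb : b ≠ 0) {c d : F}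
    (h : P.rep = c • a + d • b) :
    Projectivization.IsCollinear
      ({P, Projectivization.mk F a ha, Projectivization.mk F b hb} : Set (ℙ F V)) := by
  classical
  refine ⟨(Submodule.span F {a, b}).projectivization, ?_, ?_, ?_⟩
  · rw [Projectivization.Subspace.submodule.apply_symm_apply]
    exact Module.Finite.span_of_finite _ (Set.toFinite _)
  · rw [Projectivization.Subspace.submodule.apply_symm_apply]
    have h := finrank_span_finset_le_card (R := F) ({a, b} : Finset V)
    rw [Finset.coe_pair] at h
    exact h.trans Finset.card_le_two
  · have hP : P ∈ (Submodule.span F {a, b}).projectivization := by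
      rw [Submodule.mem_projectivization_iff_submodule_le, Projectivization.submodule_eq,
        Submodule.span_singleton_le_iff_mem, h]
      exact Submodule.mem_span_pair.2 ⟨c, d, rfl⟩
    rintro X (rfl | rfl | rfl)
    · exact hP
    · exact (Submodule.mk_mem_projectivization_iff _ _).2 (Submodule.subset_span (by simp))
    · exact (Submodule.mk_mem_projectivization_iff _ _).2 (Submodule.subset_span (by simp))

theorem exists_rep_eq_of_isCollinear {P A B : ℙ F V} (hAB : A ≠ B)
    (h : Projectivization.IsCollinear ({P, A, B} : Set (ℙ F V))) :
    ∃ c d : F, P.rep = c • A.rep + d • B.rep := by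
  obtain ⟨M, hfin, hM, hsub⟩ := h
  have hmem : ∀ X ∈ ({P, A, B} : Set (ℙ F V)), X.rep ∈ Projectivization.Subspace.submodule M := by
    intro X hX
    rw [Projectivization.Subspace.mem_submodule_iff _ X.rep_nonzero, Projectivization.mk_rep]
    exact hsub hX
  have hli := Projectivization.linearIndependent_pair_iff_ne.2 hAB
  have hle : Submodule.span F {A.rep, B.rep} ≤ Projectivization.Subspace.submodule M := by
    rw [Submodule.span_le]
    rintro x (rfl | rfl)
    · exact hmem A (by simp)
    · exact hmem B (by simp)
  have hrank : Module.finrank F (Submodule.span F {A.rep, B.rep}) = 2 := by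
    rw [← Matrix.range_cons_cons_empty _ _ ![]]
    simp [finrank_span_eq_card hli]
  have heq := Submodule.eq_of_le_of_finrank_le hle (by rw [hrank]; exact hM)
  have hP := hmem P (by simp)
  rw [← heq, Submodule.mem_span_pair] at hP
  obtain ⟨c, d, hcd⟩ := hP
  exact ⟨c, d, hcd.symm⟩

open Classical in
/-- The points represented by the nonzero elements of a set that spans by pairs form a saturating
set. -/
theorem exists_isSaturating_of_pairSpan_eq_univ {T : Finset V} (hT : pairSpan F T = Set.univ) :
    ∃ S : Finset (ℙ F V), IsSaturating (S : Set (ℙ F V)) ∧ S.card ≤ T.card := by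
  set T₀ : Finset {v : V // v ≠ 0} := T.subtype fun v => v ≠ 0 with hT₀
  refine ⟨T₀.image (Projectivization.mk' F), ?_, ?_⟩
  · have hmem : ∀ a ∈ T, ∀ ha : a ≠ 0,
        Projectivization.mk F a ha ∈ T₀.image (Projectivization.mk' F) := fun a haT ha =>
      Finset.mem_image.2 ⟨⟨a, ha⟩, by simpa [hT₀] using haT, rfl⟩
    intro P hP
    rw [Finset.mem_coe] at hP
    obtain ⟨a, haT, b, hbT, c, d, h⟩ : P.rep ∈ pairSpan F T := hT ▸ Set.mem_univ _
    -- As `P` is not in the set, its representative is not a multiple of an element of `T`.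
    have hmul : ∀ x ∈ T, ∀ z : F, P.rep ≠ z • x := by
      intro x hxT z hz
      have hx : x ≠ 0 := by
        rintro rfl
        exact P.rep_nonzero (by rw [hz, smul_zero])
      apply hP
      have : P = Projectivization.mk F x hx := by
        rw [← P.mk_rep, Projectivization.mk_eq_mk_iff']
        exact ⟨z, hz.symm⟩
      rw [this]
      exact hmem x hxT hx
    have ha : a ≠ 0 := by
      rintro rfl
      exact hmul b hbT d (by rw [h, smul_zero, zero_add])
    have hb : b ≠ 0 := by
      rintro rfl
      exact hmul a haT c (by rw [h, smul_zero, add_zero])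
    refine ⟨_, hmem a haT ha, _, hmem b hbT hb, fun hab => ?_, isCollinear_triple_of_rep_eq ha hb h⟩
    obtain ⟨z, hz⟩ := (Projectivization.mk_eq_mk_iff' F a b ha hb).1 hab
    exact hmul b hbT (c * z + d) (by rw [h, ← hz, add_smul, mul_smul])
  · refine Finset.card_image_le.trans ?_
    rw [hT₀, Finset.card_subtype]
    exact Finset.card_filter_le _ _

/-- Representatives of the points of a saturating set span by pairs. -/
theorem IsSaturating.exists_rep_eq [Nontrivial V] {S : Set (ℙ F V)} (hS : IsSaturating S) (v : V) :
    ∃ A ∈ S, ∃ B ∈ S, ∃ c d : F, v = c • A.rep + d • B.rep := by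
  have key : ∀ v : V, v ≠ 0 → ∃ A ∈ S, ∃ B ∈ S, ∃ c d : F, v = c • A.rep + d • B.rep := by
    intro v hv
    obtain ⟨u, hu⟩ := Projectivization.exists_smul_eq_mk_rep F v hv
    have hv' : v = (u⁻¹ : Fˣ) • (Projectivization.mk F v hv).rep := by rw [← hu, inv_smul_smul]
    by_cases hP : Projectivization.mk F v hv ∈ S
    · exact ⟨_, hP, _, hP, (u⁻¹ : Fˣ), 0, by rw [zero_smul, add_zero]; exact hv'⟩
    · obtain ⟨A, hA, B, hB, hAB, hcol⟩ := hS _ hP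
      obtain ⟨c, d, h⟩ := exists_rep_eq_of_isCollinear hAB hcol
      refine ⟨A, hA, B, hB, (u⁻¹ : Fˣ) * c, (u⁻¹ : Fˣ) * d, ?_⟩
      rw [mul_smul, mul_smul, ← smul_add, ← h]
      exact hv'
  by_cases hv : v = 0
  · obtain ⟨w, hw⟩ := exists_ne (0 : V)
    obtain ⟨A, hA, -⟩ := key w hw
    exact ⟨A, hA, A, hA, 0, 0, by simp [hv]⟩
  · exact key v hv

/-- In a space of dimension at least two, all the points but one form a saturating set. -/
theorem isSaturating_compl_singleton (hrank : 1 < Module.finrank F V) (P : ℙ F V) :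
    IsSaturating ({P}ᶜ : Set (ℙ F V)) := by
  intro Q hQ
  obtain rfl : Q = P := by simpa using hQ
  obtain ⟨a, ha⟩ : ∃ a : V, a ∉ Submodule.span F {Q.rep} := by
    by_contra! hall
    have htop : Submodule.span F {Q.rep} = ⊤ := Submodule.eq_top_iff'.2 hall
    have := finrank_span_singleton (K := F) Q.rep_nonzero
    rw [htop, finrank_top] at this
    omega
  have ha' : ∀ z : F, z • Q.rep ≠ a := fun z hz => ha (Submodule.mem_span_singleton.2 ⟨z, hz⟩)
  have ha0 : a ≠ 0 := fun h => ha' 0 (by rw [h, zero_smul])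
  have hb0 : Q.rep - a ≠ 0 := fun h => ha' 1 (by rw [one_smul]; exact sub_eq_zero.1 h)
  refine ⟨Projectivization.mk F a ha0, fun h => ?_, Projectivization.mk F (Q.rep - a) hb0,
    fun h => ?_, fun h => ?_,
    isCollinear_triple_of_rep_eq ha0 hb0 (c := 1) (d := 1) (by rw [one_smul, one_smul]; abel)⟩
  · obtain ⟨z, hz⟩ := (Projectivization.mk_eq_mk_iff' F _ _ ha0 Q.rep_nonzero).1
      ((Set.mem_singleton_iff.1 h).trans Q.mk_rep.symm)
    exact ha' z hz
  · obtain ⟨z, hz⟩ := (Projectivization.mk_eq_mk_iff' F _ _ hb0 Q.rep_nonzero).1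
      ((Set.mem_singleton_iff.1 h).trans Q.mk_rep.symm)
    exact ha' (1 - z) (by rw [sub_smul, one_smul, hz]; abel)
  · obtain ⟨z, hz⟩ := (Projectivization.mk_eq_mk_iff' F _ _ _ _).1 h
    rw [smul_sub, sub_eq_iff_eq_add] at hz
    by_cases h1 : 1 + z = 0
    · rw [show a + z • a = (1 + z) • a by rw [add_smul, one_smul], h1, zero_smul] at hz
      rcases smul_eq_zero.1 hz with h2 | h2
      · rw [h2, add_zero] at h1
        exact one_ne_zero h1
      · exact Q.rep_nonzero h2
    · refine ha' ((1 + z)⁻¹ * z) ?_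
      rw [mul_smul, hz, show a + z • a = (1 + z) • a by rw [add_smul, one_smul], smul_smul,
        inv_mul_cancel₀ h1, one_smul]

end Saturating

/-! ### Covering radius and saturating sets -/

section Codes

theorem map_single_eq_smul {F V : Type*} [Field F] [AddCommGroup V] [Module F V] {n : ℕ}
    (H : (Fin n → F) →ₗ[F] V) (i : Fin n) (c : F) :
    H (Pi.single i c) = c • H (Pi.single i 1) := by
  rw [← map_smul, ← Pi.single_smul, smul_eq_mul, mul_one]

theorem isLeast_smallestSaturatingSize (F : Type*) [Field F] [Finite F] (N : ℕ) :
    IsLeast (saturatingSizes F N) (smallestSaturatingSize F N) := by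
  have : Fintype (ℙ F (Fin (N + 1) → F)) := Fintype.ofFinite _
  refine ⟨Nat.sInf_mem ⟨_, Finset.univ, fun P hP => ?_, rfl⟩, fun k hk => Nat.sInf_le hk⟩
  simp at hP

variable {F : Type*} [Field F] [DecidableEq F]

theorem exists_eq_single_add_single_of_hammingNorm_le_two {ι : Type*} [Fintype ι] [DecidableEq ι]
    [Nonempty ι] {x : ι → F} (hx : hammingNorm x ≤ 2) :
    ∃ (i j : ι) (c d : F), x = Pi.single i c + Pi.single j d := by
  have hsupp : ∀ k, x k ≠ 0 → k ∈ Finset.univ.filter fun i => x i ≠ 0 := fun k hk => by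
    simpa using hk
  unfold hammingNorm at hx
  generalize (Finset.univ.filter fun i => x i ≠ 0) = s at hx hsupp
  have h : s.card = 0 ∨ s.card = 1 ∨ s.card = 2 := by omega
  rcases h with h | h | h
  · rw [Finset.card_eq_zero] at h
    obtain ⟨i⟩ := ‹Nonempty ι›
    refine ⟨i, i, 0, 0, funext fun k => ?_⟩
    have : x k = 0 := by
      by_contra hk
      simpa [h] using hsupp k hk
    simpa using this
  · obtain ⟨i, rfl⟩ := Finset.card_eq_one.1 h
    refine ⟨i, i, x i, 0, funext fun k => ?_⟩
    by_cases hk : k = i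
    · simp [hk]
    · have : x k = 0 := by
        by_contra hk'
        exact hk (by simpa using hsupp k hk')
      simp [hk, this]
  · obtain ⟨i, j, hij, rfl⟩ := Finset.card_eq_two.1 h
    refine ⟨i, j, x i, x j, funext fun k => ?_⟩
    by_cases hk : k = i
    · simp [hk, hij]
    · by_cases hk2 : k = j
      · simp [hk2, hij.symm]
      · have : x k = 0 := by
          by_contra hk'
          simpa [hk, hk2] using hsupp k hk'
        simp [hk, hk2, this]

theorem exists_eq_single_of_hammingNorm_le_one {ι : Type*} [Fintype ι] [DecidableEq ι]
    [Nonempty ι] {x : ι → F} (hx : hammingNorm x ≤ 1) :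
    ∃ (i : ι) (c : F), x = Pi.single i c := by
  obtain ⟨i, j, c, d, rfl⟩ :=
    exists_eq_single_add_single_of_hammingNorm_le_two (hx.trans one_le_two)
  by_cases hij : i = j
  · subst hij
    exact ⟨i, c + d, (Pi.single_add (f := fun _ => F) i c d).symm⟩
  by_cases hc : c = 0
  · exact ⟨j, d, by simp [hc]⟩
  by_cases hd : d = 0
  · exact ⟨i, c, by simp [hd]⟩
  exfalso
  have hsub : ({i, j} : Finset ι) ⊆
      Finset.univ.filter fun k => (Pi.single i c + Pi.single j d : ι → F) k ≠ 0 := by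
    intro k hk
    rcases Finset.mem_insert.1 hk with rfl | hk
    · simpa [hij] using hc
    · obtain rfl := Finset.mem_singleton.1 hk
      simpa [Ne.symm hij] using hd
  have := Finset.card_le_card hsub
  rw [Finset.card_pair hij] at this
  unfold hammingNorm at hx
  omega

theorem hammingNorm_single_add_single_le {ι : Type*} [Fintype ι] [DecidableEq ι] (i j : ι)
    (c d : F) : hammingNorm (Pi.single i c + Pi.single j d : ι → F) ≤ 2 := by
  refine (Finset.card_le_card (t := {i, j}) fun k hk => ?_).trans Finset.card_le_two
  by_contra hk'
  simp only [Finset.mem_insert, Finset.mem_singleton, not_or] at hk'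
  simp [hk'.1, hk'.2] at hk

theorem exists_hammingDist_le_coveringRadius {n : ℕ} (C : Submodule F (Fin n → F))
    (x : Fin n → F) : ∃ c ∈ C, hammingDist x c ≤ coveringRadius C :=
  Nat.sInf_mem (s := {ρ : ℕ | ∀ x : Fin n → F, ∃ c ∈ C, hammingDist x c ≤ ρ})
    ⟨n, fun x => ⟨0, C.zero_mem, by simpa using hammingDist_le_card_fintype (x := x) (y := 0)⟩⟩ x

/-- The columns of a parity check matrix of a code with covering radius two span by pairs, so they
contain a saturating set. -/
theorem exists_isSaturating_of_mem_coveringCodeLengths {n N : ℕ}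
    (hn : n ∈ coveringCodeLengths F 2 (N + 1)) :
    ∃ S : Finset (ℙ F (Fin (N + 1) → F)),
      IsSaturating (S : Set (ℙ F (Fin (N + 1) → F))) ∧ S.card ≤ n := by
  obtain ⟨C, hC, hR⟩ := hn
  have : Nonempty (Fin n) := ⟨⟨0, by omega⟩⟩
  have hquot : Module.finrank F ((Fin n → F) ⧸ C) = Module.finrank F (Fin (N + 1) → F) := by
    have := Submodule.finrank_quotient_add_finrank C
    simp only [Module.finrank_fin_fun] at this ⊢
    omega
  set H : (Fin n → F) →ₗ[F] (Fin (N + 1) → F) :=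
    (LinearEquiv.ofFinrankEq _ _ hquot).toLinearMap ∘ₗ C.mkQ with hH
  have hsurj : Function.Surjective H :=
    (LinearEquiv.surjective _).comp (Submodule.mkQ_surjective C)
  have hker : ∀ c ∈ C, H c = 0 := fun c hc => by
    simp [hH, (Submodule.Quotient.mk_eq_zero C).2 hc]
  obtain ⟨S, hS, hcard⟩ := exists_isSaturating_of_pairSpan_eq_univ (F := F)
    (T := Finset.univ.image fun i => H (Pi.single i 1)) (by
      refine Set.eq_univ_of_forall fun v => ?_
      obtain ⟨x, rfl⟩ := hsurj v
      obtain ⟨w, hw, hdist⟩ := exists_hammingDist_le_coveringRadius C x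
      rw [hR, hammingDist_comm, hammingDist_eq_hammingNorm] at hdist
      obtain ⟨i, j, c, d, h⟩ := exists_eq_single_add_single_of_hammingNorm_le_two hdist
      refine ⟨_, Finset.mem_image_of_mem _ (Finset.mem_univ i), _,
        Finset.mem_image_of_mem _ (Finset.mem_univ j), c, d, ?_⟩
      rw [← map_single_eq_smul, ← map_single_eq_smul, ← map_add, ← h, map_add, map_neg, hker w hw,
        neg_zero, zero_add])
  exact ⟨S, hS, hcard.trans (Finset.card_image_le.trans_eq (by simp))⟩

/-- The code whose parity check columns represent the points of a saturating set has covering radius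
two, unless the set consists of all the points. -/
theorem card_mem_coveringCodeLengths {N : ℕ} {S : Finset (ℙ F (Fin (N + 1) → F))}
    (hS : IsSaturating (S : Set (ℙ F (Fin (N + 1) → F)))) {P : ℙ F (Fin (N + 1) → F)}
    (hP : P ∉ S) : S.card ∈ coveringCodeLengths F 2 (N + 1) := by
  set h : Fin S.card → (Fin (N + 1) → F) := fun i => (S.equivFin.symm i).1.rep with hh
  set H : (Fin S.card → F) →ₗ[F] (Fin (N + 1) → F) := Fintype.linearCombination F h with hH
  have hsingle : ∀ i c, H (Pi.single i c) = c • h i := fun i c => by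
    rw [hH, Fintype.linearCombination_apply_single]
  have hcover : ∀ v, ∃ i j c d, v = H (Pi.single i c + Pi.single j d) := by
    intro v
    obtain ⟨A, hA, B, hB, c, d, hv⟩ := hS.exists_rep_eq v
    refine ⟨S.equivFin ⟨A, hA⟩, S.equivFin ⟨B, hB⟩, c, d, ?_⟩
    rw [map_add, hsingle, hsingle, hv]
    simp [hh]
  have : Nonempty (Fin S.card) := (hcover 0).nonempty
  have hsurj : Function.Surjective H := fun v => by
    obtain ⟨i, j, c, d, hv⟩ := hcover v
    exact ⟨_, hv.symm⟩
  refine ⟨LinearMap.ker H, ?_, le_antisymm (Nat.sInf_le fun x => ?_) ?_⟩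
  · have := LinearMap.finrank_range_add_finrank_ker H
    rw [LinearMap.range_eq_top.2 hsurj, finrank_top] at this
    simp only [Module.finrank_fin_fun] at this
    omega
  · obtain ⟨i, j, c, d, hx⟩ := hcover (H x)
    refine ⟨x - (Pi.single i c + Pi.single j d), ?_, ?_⟩
    · rw [LinearMap.mem_ker, map_sub, ← hx, sub_self]
    · rw [hammingDist_comm, hammingDist_eq_hammingNorm, neg_sub, sub_add_cancel]
      exact hammingNorm_single_add_single_le i j c d
  · -- With covering radius at most one, every vector would be a multiple of one column.
    by_contra hlt
    obtain ⟨x, hx⟩ := hsurj P.rep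
    obtain ⟨w, hw, hdist⟩ := exists_hammingDist_le_coveringRadius (LinearMap.ker H) x
    rw [hammingDist_comm, hammingDist_eq_hammingNorm] at hdist
    obtain ⟨i, c, hc⟩ := exists_eq_single_of_hammingNorm_le_one (hdist.trans (by omega))
    have hPi : P.rep = c • h i := by
      rw [← hsingle, ← hc, map_add, map_neg, hx, LinearMap.mem_ker.1 hw, neg_zero, zero_add]
    apply hP
    have : P = (S.equivFin.symm i).1 := by
      rw [← P.mk_rep, ← (S.equivFin.symm i).1.mk_rep, Projectivization.mk_eq_mk_iff']
      exact ⟨c, hPi.symm⟩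
    rw [this]
    exact (S.equivFin.symm i).2

variable [Finite F]

/-- A smallest saturating set gives a code of covering radius two, since it does not contain all
points. -/
theorem smallestSaturatingSize_mem_coveringCodeLengths {N : ℕ} (hN : 0 < N) :
    smallestSaturatingSize F N ∈ coveringCodeLengths F 2 (N + 1) := by
  classical
  have : Fintype (ℙ F (Fin (N + 1) → F)) := Fintype.ofFinite _
  obtain ⟨⟨S, hS, hcard⟩, hmin⟩ := isLeast_smallestSaturatingSize F N
  obtain ⟨P, hP⟩ : ∃ P, P ∉ S := by
    by_contra! hall
    obtain ⟨P⟩ : Nonempty (ℙ F (Fin (N + 1) → F)) := inferInstance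
    have hsat : IsSaturating ((S.erase P : Finset _) : Set (ℙ F (Fin (N + 1) → F))) := by
      convert isSaturating_compl_singleton (by rw [Module.finrank_fin_fun]; omega) P
      ext Q
      simp [hall Q]
    have h1 := hmin ⟨S.erase P, hsat, rfl⟩
    have h2 := Finset.card_erase_lt_of_mem (hall P)
    omega
  rw [← hcard]
  exact card_mem_coveringCodeLengths hS hP

theorem isLeast_smallestSaturatingSize_coveringCodeLengths {N : ℕ} (hN : 0 < N) :
    IsLeast (coveringCodeLengths F 2 (N + 1)) (smallestSaturatingSize F N) := by
  refine ⟨smallestSaturatingSize_mem_coveringCodeLengths hN, fun n hn => ?_⟩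
  obtain ⟨S, hS, hcard⟩ := exists_isSaturating_of_mem_coveringCodeLengths hn
  exact ((isLeast_smallestSaturatingSize F N).2 ⟨S, hS, rfl⟩).trans hcard

end Codes

/-! ### Asymptotics of the bound -/

open Filter Asymptotics Topology

theorem Asymptotics.IsEquivalent.sqrt_of_nonneg {α : Type*} {l : Filter α} {u v : α → ℝ}
    (h : IsEquivalent l u v) : IsEquivalent l (fun x => √(u x)) (fun x => √(v x)) := by
  obtain ⟨φ, hφ, huv⟩ := h.exists_eq_mul
  refine isEquivalent_iff_exists_eq_mul.2 ⟨fun x => √(φ x), ?_, ?_⟩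
  · simpa [Function.comp_def] using (Real.continuous_sqrt.tendsto 1).comp hφ
  · filter_upwards [huv, hφ.eventually (lt_mem_nhds one_pos)] with x hx hpos
    rw [hx, Pi.mul_apply, Pi.mul_apply, Real.sqrt_mul hpos.le]

theorem isEquivalent_natCast_add_one :
    IsEquivalent atTop (fun q : ℕ => (q : ℝ) + 1) fun q : ℕ => (q : ℝ) :=
  IsEquivalent.refl.add_isLittleO
    ((isLittleO_const_id_atTop (1 : ℝ)).comp_tendsto tendsto_natCast_atTop_atTop)

theorem isEquivalent_sqrt_add_one_mul_log :
    IsEquivalent atTop (fun q : ℕ => √(((q : ℝ) + 1) * Real.log ((q : ℝ) + 1)))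
      fun q : ℕ => √((q : ℝ) * Real.log (q : ℝ)) := by
  refine IsEquivalent.sqrt_of_nonneg (isEquivalent_natCast_add_one.mul ?_)
  exact isEquivalent_natCast_add_one.log tendsto_natCast_atTop_atTop

theorem isEquivalent_saturatingBound (N : ℕ) :
    IsEquivalent atTop (fun q : ℕ => saturatingBound N q)
      (fun q : ℕ => 2 * (q : ℝ) ^ (((N : ℝ) - 1) / 2) * √(Real.log (q : ℝ))) := by
  set a : ℕ → ℝ := fun q => (q : ℝ) ^ (((N : ℝ) - 2) / 2) with ha
  set s : ℕ → ℝ := fun q => √((q : ℝ) * Real.log (q : ℝ)) with hs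
  have hg : (fun q : ℕ => 2 * (q : ℝ) ^ (((N : ℝ) - 1) / 2) * √(Real.log (q : ℝ))) =ᶠ[atTop]
      fun q => 2 * s q * a q := by
    filter_upwards [eventually_gt_atTop 0] with q hq
    have hq' : (0 : ℝ) < q := by exact_mod_cast hq
    rw [hs, ha]
    simp only
    rw [Real.sqrt_mul hq'.le, Real.sqrt_eq_rpow (q : ℝ),
      show ((N : ℝ) - 1) / 2 = 1 / 2 + ((N : ℝ) - 2) / 2 by ring, Real.rpow_add hq']
    ring
  have hs_top : Tendsto s atTop atTop := by
    refine Real.tendsto_sqrt_atTop.comp (Tendsto.atTop_mul_atTop₀ tendsto_natCast_atTop_atTop ?_)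
    exact Real.tendsto_log_atTop.comp tendsto_natCast_atTop_atTop
  have ha_o : a =o[atTop] fun q => 2 * s q * a q := by
    have h1 : (fun _ : ℕ => (1 : ℝ)) =o[atTop] fun q => 2 * s q :=
      (isLittleO_const_left.2 (Or.inr (tendsto_norm_atTop_atTop.comp
        (hs_top.const_mul_atTop two_pos))))
    simpa using h1.mul_isBigO (isBigO_refl a atTop)
  have hrest : (fun q : ℕ => 2 * a q + 2 * (q : ℝ) ^ (((N : ℝ) - 4) / 2)) =O[atTop] a := by
    refine ((isBigO_refl a atTop).const_mul_left 2).add (IsBigO.const_mul_left ?_ 2)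
    refine IsBigO.of_bound 1 ?_
    filter_upwards [eventually_ge_atTop 1] with q hq
    have hq' : (1 : ℝ) ≤ q := by exact_mod_cast hq
    rw [one_mul, Real.norm_of_nonneg (by positivity), Real.norm_of_nonneg (by positivity)]
    exact Real.rpow_le_rpow_of_exponent_le hq' (by linarith)
  have hmain : IsEquivalent atTop
      (fun q : ℕ => 2 * √(((q : ℝ) + 1) * Real.log ((q : ℝ) + 1)) * a q)
      (fun q => 2 * s q * a q) :=
    (IsEquivalent.refl.mul isEquivalent_sqrt_add_one_mul_log).mul IsEquivalent.refl
  refine ((hmain.add_isLittleO (hrest.trans_isLittleO ha_o)).congr_left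
    (Eventually.of_forall fun q => ?_)).congr_right hg.symm
  simp only [Pi.add_apply, saturatingBound, ha]
  ring

theorem mainTheorem4 (N t : ℕ) (hN : N = 2 * t - 2) (ht : t = 4 ∨ t = 6 ∨ 8 ≤ t) :
    (∀ (F : Type*) [Field F] [Fintype F] [DecidableEq F], 79 ≤ Fintype.card F →
      IsLeast (saturatingSizes F N) (smallestSaturatingSize F N) ∧
      IsLeast (coveringCodeLengths F 2 (N + 1)) (lengthFunction F 2 (N + 1)) ∧
      smallestSaturatingSize F N = lengthFunction F 2 (N + 1) ∧
      (smallestSaturatingSize F N : ℝ) ≤ saturatingBound N (Fintype.card F)) ∧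
    Asymptotics.IsEquivalent Filter.atTop
      (fun q : ℕ => saturatingBound N q)
      (fun q : ℕ => 2 * (q : ℝ) ^ (((N : ℝ) - 1) / 2) * Real.sqrt (Real.log (q : ℝ))) := by
  refine ⟨fun F _ _ _ hq => ?_, isEquivalent_saturatingBound N⟩
  have hcode := isLeast_smallestSaturatingSize_coveringCodeLengths (F := F) (N := N) (by omega)
  have heq : smallestSaturatingSize F N = lengthFunction F 2 (N + 1) := hcode.csInf_eq.symm
  refine ⟨isLeast_smallestSaturatingSize F N, heq ▸ hcode, heq, ?_⟩
  obtain ⟨T, hT, hTcard⟩ := exists_pairSpan_eq_univ_odd F hq (n := N + 1) (m := t - 2)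
    (by omega) (by omega)
  obtain ⟨S, hS, hScard⟩ := exists_isSaturating_of_pairSpan_eq_univ hT
  have hle : smallestSaturatingSize F N ≤ T.card :=
    ((isLeast_smallestSaturatingSize F N).2 ⟨S, hS, rfl⟩).trans hScard
  have hexp : ((N : ℝ) - 2) / 2 = ((t - 2 : ℕ) : ℝ) := by
    have : N = 2 * (t - 2) + 2 := by omega
    rw [this]
    push_cast
    ring
  rw [saturatingBound, hexp, Real.rpow_natCast]
  have hnonneg : 0 ≤ 2 * (Fintype.card F : ℝ) ^ (((N : ℝ) - 4) / 2) := by positivity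
  have hle' : (smallestSaturatingSize F N : ℝ) ≤ T.card := by exact_mod_cast hle
  linarith
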